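/- Consider a bar-joint framework with finitely many knots in $\mathbb R^d$, coordinatized by real unknowns $z=(z_1,\dots,z_m)$. The coordinates of the knots are polynomials in $z$ (typically single unknowns, or constants for pinned knots), there is a finite set of bars, and there may be finitely many additional polynomial side conditions $s(z)=0$ (such as the linear conditions that eliminate the isometries). A configuration is a point $X\in\mathbb R^m$ that satisfies the side conditions and at which no bar has length $0$; let $\mathcal S$ be the set of all configurations. The bar lengths of $X$ together with the side conditions give the constraint system $c_1=\dots=c_l=0$, where each bar contributes the equation that its squared length equals its squared length in $X$. The gradients $\nabla c_1,\dots,\nabla c_l$, as polynomials in $z$, do not depend on the bar lengths. Let $I_0=0$. For $j\ge 0$ let $I_{j+1}$ be the ideal of $\mathbb R[z_1,\dots,z_m]$ generated by $I_j$ and by all $m\times m$ minors of the matrices whose columns are taken from $\nabla c_1,\dots,\nabla c_l$ and the gradients $\nabla g$, $g\in I_j$. The $j$-th shakiness variety $V_j\subset\mathbb R^m$ is the zero set of $I_j$; thus $V_1$ is the set where the rigidity matrix $(\nabla c_1,\dots,\nabla c_l)$ has rank less than $m$. A point $X\in V_j$ is called a regular point of $V_j$ if near $X$ the set $V_j$ is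 the common zero set of finitely many elements of $I_j$ whose gradients at $X$ are linearly independent; the other points of $V_j$ are called singular. Put $\mathcal S_0=\mathcal S$, and let $\mathcal S_{j+1}$ consist of those $X\in\mathcal S_j$ that have a non-trivial first-order flex tangential to $V_j$, that is, a vector $v\ne 0$ with $\nabla c_i(X)\cdot v=0$ for all $i$ and $\nabla g(X)\cdot v=0$ for all $g\in I_j$. The configuration $X$ is called $n$-th order flexible if $X\in\mathcal S_n\setminus\mathcal S_{n+1}$. Theorem. Let $n\ge 0$ be an integer and let $X$ be a configuration that is not a singular point of any of the varieties $V_1,\dots,V_n$ (for example, a regular point of each of them). Then $X$ is $n$-th order flexible if and only if $X$ is a realization of multiplicity $n+1$, that is, the local ring at $X$ of $\mathbb R[z_1,\dots,z_m]/(c_1,\dots,c_l)$ has length $n+1$. -/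

import Mathlib

open MvPolynomial

/-- The gradient of a polynomial `g` in the unknowns `z₁, …, z_m`, evaluated at the point `X`. -/
noncomputable def polyGradient {m : ℕ} (g : MvPolynomial (Fin m) ℝ) (X : Fin m → ℝ) :
    Fin m → ℝ :=
  fun a => eval X (pderiv a g)

/-- The real zero set in `ℝ^m` of an ideal of polynomials. -/
def realZeros {m : ℕ} (I : Ideal (MvPolynomial (Fin m) ℝ)) : Set (Fin m → ℝ) :=
  {X | ∀ g ∈ I, eval X g = 0}

/-- `v` is tangential at `X` to the variety given by the ideal `I`: it is annihilated by the
differentials at `X` of all elements of `I`. -/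
def IsTangentTo {m : ℕ} (I : Ideal (MvPolynomial (Fin m) ℝ)) (X v : Fin m → ℝ) : Prop :=
  ∀ g ∈ I, polyGradient g X ⬝ᵥ v = 0

/-- `X` is a regular point of the variety given by the ideal `I`: near `X` the variety is the
common zero set of finitely many elements of `I` whose gradients at `X` are linearly independent
(so the rank of the gradients of the elements of `I` at `X` is the codimension of the variety
at `X`). -/
def IsRegularPoint {m : ℕ} (I : Ideal (MvPolynomial (Fin m) ℝ)) (X : Fin m → ℝ) : Prop :=
  X ∈ realZeros I ∧
    ∃ (k : ℕ) (g : Fin k → MvPolynomial (Fin m) ℝ),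
      (∀ i, g i ∈ I) ∧
      LinearIndependent ℝ (fun i => polyGradient (g i) X) ∧
      ∀ᶠ Y in nhds X, (∀ i, eval Y (g i) = 0) → Y ∈ realZeros I

/-- The ideal generated by all `m × m` minors of the matrix whose columns are the gradients of
the polynomials in `A`.  (A choice with repeated columns contributes the zero polynomial.) -/
noncomputable def gradientMinors {m : ℕ} (A : Set (MvPolynomial (Fin m) ℝ)) :
    Ideal (MvPolynomial (Fin m) ℝ) :=
  Ideal.span {p | ∃ f : Fin m → MvPolynomial (Fin m) ℝ, (∀ b, f b ∈ A) ∧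
    p = Matrix.det (Matrix.of fun a b => pderiv a (f b))}

/-- The maximal ideal of all polynomials that vanish at `X`. -/
noncomputable def pointIdeal {m : ℕ} (X : Fin m → ℝ) : Ideal (MvPolynomial (Fin m) ℝ) :=
  RingHom.ker (eval X)

instance pointIdeal_isPrime {m : ℕ} (X : Fin m → ℝ) : (pointIdeal X).IsPrime :=
  RingHom.ker_isPrime (eval X)

/-- The multiplicity of the point `X` as a solution of the system `c = 0`, `c ∈ A`: the length of
the local ring at `X` of `ℝ[z₁, …, z_m] / (A)`.  It is `0` if `X` is not a solution and `⊤` if `X`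
is not an isolated complex solution. -/
noncomputable def solutionMultiplicity {m : ℕ} (A : Set (MvPolynomial (Fin m) ℝ))
    (X : Fin m → ℝ) : ℕ∞ :=
  Module.length (Localization.AtPrime (pointIdeal X))
    (Localization.AtPrime (pointIdeal X) ⧸
      (Ideal.span A).map
        (algebraMap (MvPolynomial (Fin m) ℝ) (Localization.AtPrime (pointIdeal X))))

/-- A bar-joint framework with `w` knots in `ℝ^d`, coordinatized by `m` unknowns, without its
intrinsic metric.
* `bars` is the graph on the knots.
* `knot i k` is the `k`-th coordinate of the `i`-th knot as a polynomial in the unknowns: one of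
  the unknowns for a free knot, a constant for a pinned one.
* `side` is the list of the remaining equations `s = 0`, such as the linear conditions that
  eliminate the isometries or that come from a knot at infinity. -/
structure Framework (d w m : ℕ) where
  bars : SimpleGraph (Fin w)
  knot : Fin w → Fin d → MvPolynomial (Fin m) ℝ
  side : Finset (MvPolynomial (Fin m) ℝ)

namespace Framework

variable {d w m : ℕ}

/-- The squared distance of two knots as a polynomial in the unknowns. -/
noncomputable def sqDist (F : Framework d w m) (i j : Fin w) : MvPolynomial (Fin m) ℝ :=
  ∑ k, (F.knot i k - F.knot j k) ^ 2

/-- The constraint polynomials `c₁, …, c_l` of the framework with the intrinsic metric of the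
configuration `X`: one for each bar, fixing its squared length to the value in `X`, and the side
conditions. -/
noncomputable def constraints (F : Framework d w m) (X : Fin m → ℝ) :
    Set (MvPolynomial (Fin m) ℝ) :=
  {c | ∃ i j, F.bars.Adj i j ∧ c = F.sqDist i j - C (eval X (F.sqDist i j))} ∪ ↑F.side

/-- The configuration set: the side conditions hold and no bar has length zero. -/
def configurations (F : Framework d w m) : Set (Fin m → ℝ) :=
  {X | (∀ s ∈ F.side, eval X s = 0) ∧ ∀ i j, F.bars.Adj i j → eval X (F.sqDist i j) ≠ 0}

/-- `v` is a non-trivial first-order flex at `X`: it is non-zero and does not change any of the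
constraints instantaneously.  (The side conditions are meant to exclude the isometries, so that
only the zero velocity originates from a rigid body motion.) -/
def IsFlex (F : Framework d w m) (X v : Fin m → ℝ) : Prop :=
  v ≠ 0 ∧ ∀ c ∈ F.constraints X, polyGradient c X ⬝ᵥ v = 0

/-- The ideals of the iterated shakiness varieties.  `shakyIdeal 1` is generated by the `m × m`
minors of the rigidity matrix `(∇c₁, …, ∇c_l)`; `shakyIdeal (j+1)` arises from `shakyIdeal j`
by adding the `m × m` minors of the matrix formed by `∇c₁, …, ∇c_l` and by the gradients of the
elements of `shakyIdeal j`, which express that some non-trivial first-order flex is tangential to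
the variety of `shakyIdeal j`.  The recursion starts with the zero ideal, that is with the whole
space.  The gradients of the constraints do not depend on the intrinsic metric, so
the metric of the configuration `0` is used. -/
noncomputable def shakyIdeal (F : Framework d w m) : ℕ → Ideal (MvPolynomial (Fin m) ℝ)
  | 0 => ⊥
  | j + 1 => F.shakyIdeal j ⊔ gradientMinors (F.constraints 0 ∪ ↑(F.shakyIdeal j))

/-- The iterated shakiness variety `V_j`. -/
def shakyVariety (F : Framework d w m) (j : ℕ) : Set (Fin m → ℝ) :=
  realZeros (F.shakyIdeal j)

/-- The hierarchy `S = S_0 ⊇ S_1 ⊇ S_2 ⊇ …`: a configuration of `S_j` belongs to `S_{j+1}` if it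
has a non-trivial first-order flex that is tangential to `V_j`.  For `j = 0` tangency is no
condition, so `S_1` is the set of first-order flexible configurations. -/
def flexibleSet (F : Framework d w m) : ℕ → Set (Fin m → ℝ)
  | 0 => F.configurations
  | j + 1 => {X | X ∈ F.flexibleSet j ∧ ∃ v, F.IsFlex X v ∧ IsTangentTo (F.shakyIdeal j) X v}

/-- Flexibility of order exactly `n` in the hierarchical sense. -/
def IsFlexibleOfOrder (F : Framework d w m) (n : ℕ) (X : Fin m → ℝ) : Prop :=
  X ∈ F.flexibleSet n ∧ X ∉ F.flexibleSet (n + 1)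

/-- The multiplicity of a configuration as a realization of the framework with its own intrinsic
metric. -/
noncomputable def realizationMultiplicity (F : Framework d w m) (X : Fin m → ℝ) : ℕ∞ :=
  solutionMultiplicity (F.constraints X) X

end Framework

open scoped Matrix

/-! Let `r` be the rank of the rigidity matrix at `X`. Vanishing of all maximal minors means a
common nonzero annihilator, so `X` lies in `S_j` iff every element of `I_j` vanishes at `X`
(`mem_flexibleSet_iff`).

If `r ≥ m - 1`, choose `m - 1` constraints with independent gradients at `X`. They cut out a smooth
curve germ; the order of vanishing along it is encoded in `curveIdeal`. Up to units at `X`,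
differentiation along the curve is a maximal minor, so passing from `I_j` to `I_{j+1}` lowers the
minimal order of the constraints and of `I_j` by exactly one until it reaches zero. Hence `I_j`
vanishes at `X` iff all constraints have order at least `j + 1` (`shakyIdeal_le_pointIdeal_iff`).
The minimal order is also the multiplicity, since the local ring of the curve is a discrete
valuation ring in effect (`solutionMultiplicity_eq_add_one_iff`). This case needs no regularity.

If `r ≤ m - 2`, all minors vanish at `X` to second order. For `n = 0` both sides fail. For `n ≥ 1`,
a regular point of `V_1` without nonzero gradients forces `I_1 = 0`, so all `I_j` vanish and `X` is
flexible of every order. The multiplicity is then infinite: by Zariski's main theorem, finite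
multiplicity makes the polynomial ring integral over the algebra of constraints after inverting one
element, so no nonzero derivation kills the constraints, whereas vanishing minors provide one
(`exists_minor_ne_zero_of_solutionMultiplicity_ne_top`). -/

theorem forall_det_eq_zero_iff_exists_dotProduct_eq_zero {K : Type*} [Field K] {m : ℕ}
    (s : Set (Fin m → K)) :
    (∀ f : Fin m → Fin m → K, (∀ b, f b ∈ s) → Matrix.det (Matrix.of fun a b => f b a) = 0) ↔
      ∃ v : Fin m → K, v ≠ 0 ∧ ∀ w ∈ s, w ⬝ᵥ v = 0 := by
  constructor
  · intro h
    have hs : Submodule.span K s ≠ ⊤ := by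
      intro hs
      have hfin : Module.finrank K (Submodule.span K s) = m := by
        rw [hs, finrank_top, Module.finrank_fin_fun]
      obtain ⟨f, hf, hspan, hli⟩ := Submodule.exists_fun_fin_finrank_span_eq K s
      have hli' : LinearIndependent K (f ∘ Fin.cast hfin.symm) :=
        hli.comp _ (Fin.cast_injective _)
      have hunit := Matrix.linearIndependent_rows_iff_isUnit
        (A := Matrix.of (f ∘ Fin.cast hfin.symm)) |>.1 hli'
      rw [Matrix.isUnit_iff_isUnit_det, ← Matrix.det_transpose] at hunit
      exact hunit.ne_zero (h (f ∘ Fin.cast hfin.symm) fun b => hf _)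
    obtain ⟨φ, hφ, hle⟩ := Submodule.exists_le_ker_of_lt_top _ hs.lt_top
    refine ⟨fun a => φ (Pi.single a 1), fun h0 => hφ ?_, fun w hw => ?_⟩
    · refine LinearMap.pi_ext' fun a => LinearMap.ext_ring ?_
      simpa using congrFun h0 a
    · have h1 : φ w = 0 := hle (Submodule.subset_span hw)
      rw [LinearMap.pi_apply_eq_sum_univ φ w] at h1
      rw [dotProduct, ← h1]
      refine Finset.sum_congr rfl fun a _ => ?_
      rw [smul_eq_mul]
      congr 2
      ext j
      simp [Pi.single_apply, eq_comm]
  · rintro ⟨v, hv, hs⟩ f hf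
    rw [← Matrix.exists_vecMul_eq_zero_iff]
    refine ⟨v, hv, funext fun b => ?_⟩
    rw [Matrix.vecMul, dotProduct_comm]
    exact hs _ (hf b)

/-! ### Gradients and the cotangent space at a point -/

section Gradient

variable {m : ℕ} {X : Fin m → ℝ}

theorem mem_pointIdeal {g : MvPolynomial (Fin m) ℝ} : g ∈ pointIdeal X ↔ eval X g = 0 :=
  Iff.rfl

instance pointIdeal_isMaximal (X : Fin m → ℝ) : (pointIdeal X).IsMaximal :=
  RingHom.ker_isMaximal_of_surjective (eval X) fun r => ⟨C r, by simp⟩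

theorem polyGradient_add (f g : MvPolynomial (Fin m) ℝ) :
    polyGradient (f + g) X = polyGradient f X + polyGradient g X := by
  ext; simp [polyGradient]

theorem polyGradient_mul (f g : MvPolynomial (Fin m) ℝ) :
    polyGradient (f * g) X = eval X f • polyGradient g X + eval X g • polyGradient f X := by
  ext; simp [polyGradient]

@[simp] theorem polyGradient_C (r : ℝ) : polyGradient (C r) X = 0 := by
  ext; simp [polyGradient]

theorem polyGradient_zero : polyGradient (0 : MvPolynomial (Fin m) ℝ) X = 0 := by
  ext; simp [polyGradient]

theorem polyGradient_sub (f g : MvPolynomial (Fin m) ℝ) :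
    polyGradient (f - g) X = polyGradient f X - polyGradient g X := by
  ext; simp [polyGradient]

theorem polyGradient_sum {ι : Type*} (s : Finset ι) (f : ι → MvPolynomial (Fin m) ℝ) :
    polyGradient (∑ i ∈ s, f i) X = ∑ i ∈ s, polyGradient (f i) X := by
  ext; simp [polyGradient]

theorem polyGradient_X_sub_C (a : Fin m) (r : ℝ) :
    polyGradient (MvPolynomial.X a - C r) X = Pi.single a 1 := by
  ext b
  rcases eq_or_ne a b with rfl | h <;> simp [polyGradient, pderiv_X, *]

theorem sub_C_eval_mem_span (g : MvPolynomial (Fin m) ℝ) :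
    g - C (eval X g) ∈
      Ideal.span (Set.range fun a => (MvPolynomial.X a - C (X a) : MvPolynomial (Fin m) ℝ)) := by
  induction g using MvPolynomial.induction_on with
  | C r => simp
  | add p q hp hq =>
    have := add_mem hp hq
    convert this using 1
    simp only [map_add]; ring
  | mul_X p a hp =>
    have h1 := Ideal.mul_mem_right (C (X a)) _ hp
    have h2 := Ideal.mul_mem_left _ p (Ideal.subset_span (Set.mem_range_self (f := fun a =>
      (MvPolynomial.X a - C (X a) : MvPolynomial (Fin m) ℝ)) a))
    convert add_mem h1 h2 using 1
    simp only [map_mul, eval_X]; ring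

theorem pointIdeal_eq_span (X : Fin m → ℝ) :
    pointIdeal X =
      Ideal.span (Set.range fun a => (MvPolynomial.X a - C (X a) : MvPolynomial (Fin m) ℝ)) := by
  apply le_antisymm
  · intro g hg
    simpa [mem_pointIdeal.1 hg] using sub_C_eval_mem_span (X := X) g
  · rw [Ideal.span_le]
    rintro _ ⟨a, rfl⟩
    simp [mem_pointIdeal]

theorem mul_mem_pointIdeal_sq {f g : MvPolynomial (Fin m) ℝ} (hf : f ∈ pointIdeal X)
    (hg : g ∈ pointIdeal X) : f * g ∈ pointIdeal X ^ 2 := by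
  rw [pow_two]; exact Ideal.mul_mem_mul hf hg

theorem mem_pointIdeal_sq_of_polyGradient_eq_zero {g : MvPolynomial (Fin m) ℝ}
    (hg : g ∈ pointIdeal X) (h : polyGradient g X = 0) : g ∈ pointIdeal X ^ 2 := by
  have hg' := hg
  rw [pointIdeal_eq_span, Ideal.mem_span_range_iff_exists_fun] at hg'
  obtain ⟨c, rfl⟩ := hg'
  have hc : ∀ a, eval X (c a) = 0 := by
    intro a
    have := congrFun h a
    simpa [polyGradient_sum, polyGradient_mul, polyGradient_X_sub_C, Pi.single_apply] using this
  exact Ideal.sum_mem _ fun a _ => mul_mem_pointIdeal_sq (hc a) (by simp [mem_pointIdeal])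

/-- The gradients of `f` form a basis, so subtracting a constant combination of the `f b` removes
the linear part of any `g` vanishing at `X`. -/
theorem pointIdeal_le_span_sup_sq {f : Fin m → MvPolynomial (Fin m) ℝ}
    (hdet : Matrix.det (Matrix.of fun a b => polyGradient (f b) X a) ≠ 0)
    (hf : ∀ b, f b ∈ pointIdeal X) :
    pointIdeal X ≤ Ideal.span (Set.range f) ⊔ pointIdeal X ^ 2 := by
  intro g hg
  set P : Matrix (Fin m) (Fin m) ℝ := Matrix.of fun a b => polyGradient (f b) X a
  set c := P⁻¹.mulVec (polyGradient g X)
  have hc : P.mulVec c = polyGradient g X := by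
    rw [Matrix.mulVec_mulVec, Matrix.mul_nonsing_inv _ (isUnit_iff_ne_zero.2 hdet),
      Matrix.one_mulVec]
  have h1 : ∑ b, C (c b) * f b ∈ Ideal.span (Set.range f) :=
    Ideal.sum_mem _ fun b _ => Ideal.mul_mem_left _ _ (Ideal.subset_span ⟨b, rfl⟩)
  have h2 : ∑ b, C (c b) * f b ∈ pointIdeal X :=
    Ideal.sum_mem _ fun b _ => Ideal.mul_mem_left _ _ (hf b)
  have h3 : g - ∑ b, C (c b) * f b ∈ pointIdeal X ^ 2 := by
    apply mem_pointIdeal_sq_of_polyGradient_eq_zero (sub_mem hg h2)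
    rw [polyGradient_sub, polyGradient_sum, ← hc, sub_eq_zero]
    ext a
    simp [polyGradient_mul, Matrix.mulVec, dotProduct, P, mul_comm]
  have := Submodule.add_mem_sup h1 h3
  simpa using this

theorem eval_det_pderiv (f : Fin m → MvPolynomial (Fin m) ℝ) :
    eval X (Matrix.det (Matrix.of fun a b => pderiv a (f b))) =
      Matrix.det (Matrix.of fun a b => polyGradient (f b) X a) := by
  rw [RingHom.map_det]; rfl

theorem gradientMinors_le_pointIdeal_iff (A : Set (MvPolynomial (Fin m) ℝ)) :
    gradientMinors A ≤ pointIdeal X ↔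
      ∃ v : Fin m → ℝ, v ≠ 0 ∧ ∀ g ∈ A, polyGradient g X ⬝ᵥ v = 0 := by
  have := forall_det_eq_zero_iff_exists_dotProduct_eq_zero ((fun g => polyGradient g X) '' A)
  simp only [Set.forall_mem_image] at this
  rw [← this, gradientMinors, Ideal.span_le]
  constructor
  · intro h f hf
    choose p hp hpf using hf
    have := h ⟨p, hp, rfl⟩
    rw [SetLike.mem_coe, mem_pointIdeal, eval_det_pderiv] at this
    simpa [hpf] using this
  · rintro h _ ⟨f, hf, rfl⟩
    rw [SetLike.mem_coe, mem_pointIdeal, eval_det_pderiv]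
    exact h _ fun b => ⟨f b, hf b, rfl⟩

end Gradient

/-! ### The flexibility hierarchy in terms of ideals -/

namespace Framework

variable {d w m : ℕ} (F : Framework d w m)

theorem constraints_subset_pointIdeal {X : Fin m → ℝ} (hX : X ∈ F.configurations) :
    F.constraints X ⊆ pointIdeal X := by
  rintro c (⟨i, j, -, rfl⟩ | hc)
  · simp [mem_pointIdeal]
  · exact hX.1 c hc

theorem exists_constraints_pderiv_eq (X Y : Fin m → ℝ) {c : MvPolynomial (Fin m) ℝ}
    (hc : c ∈ F.constraints X) : ∃ c' ∈ F.constraints Y, ∀ a, pderiv a c' = pderiv a c := by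
  obtain ⟨i, j, hij, rfl⟩ | hc := hc
  · exact ⟨_, Or.inl ⟨i, j, hij, rfl⟩, fun a => by simp⟩
  · exact ⟨c, Or.inr hc, fun _ => rfl⟩

theorem gradientMinors_constraints_union_le (X Y : Fin m → ℝ)
    (I : Set (MvPolynomial (Fin m) ℝ)) :
    gradientMinors (F.constraints X ∪ I) ≤ gradientMinors (F.constraints Y ∪ I) := by
  refine Ideal.span_mono ?_
  rintro _ ⟨f, hf, rfl⟩
  have : ∀ b, ∃ g ∈ F.constraints Y ∪ I, ∀ a, pderiv a g = pderiv a (f b) := by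
    intro b
    rcases hf b with h | h
    · obtain ⟨c, hc, h⟩ := F.exists_constraints_pderiv_eq X Y h
      exact ⟨c, Or.inl hc, h⟩
    · exact ⟨f b, Or.inr h, fun _ => rfl⟩
  choose g hg hgf using this
  exact ⟨g, hg, by simp [hgf]⟩

theorem shakyIdeal_succ (X : Fin m → ℝ) (j : ℕ) :
    F.shakyIdeal (j + 1) =
      F.shakyIdeal j ⊔ gradientMinors (F.constraints X ∪ F.shakyIdeal j) := by
  rw [shakyIdeal, (F.gradientMinors_constraints_union_le 0 X _).antisymm
    (F.gradientMinors_constraints_union_le X 0 _)]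

theorem shakyIdeal_mono : Monotone F.shakyIdeal :=
  monotone_nat_of_le_succ fun j => by rw [shakyIdeal]; exact le_sup_left

theorem mem_flexibleSet_iff {X : Fin m → ℝ} (hX : X ∈ F.configurations) (j : ℕ) :
    X ∈ F.flexibleSet j ↔ F.shakyIdeal j ≤ pointIdeal X := by
  induction j with
  | zero => simpa [flexibleSet, shakyIdeal] using hX
  | succ j ih =>
    rw [F.shakyIdeal_succ X, sup_le_iff, ← ih, gradientMinors_le_pointIdeal_iff]
    simp only [flexibleSet, Set.mem_ofPred_eq, IsFlex, IsTangentTo, Set.mem_union, or_imp,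
      forall_and, and_assoc, SetLike.mem_coe]

end Framework

/-! ### Order of vanishing along a smooth curve germ -/

section Curve

variable {m : ℕ} (f : Fin m → MvPolynomial (Fin m) ℝ) (i₀ : Fin m) (X : Fin m → ℝ)

/-- The derivation along the curve on which all `f b` with `b ≠ i₀` are constant: `g` is mapped to
the Jacobian determinant of the family `f` with `f i₀` replaced by `g`. -/
noncomputable def curveDerivation :
    Derivation ℝ (MvPolynomial (Fin m) ℝ) (MvPolynomial (Fin m) ℝ) :=
  ∑ a, (Matrix.of fun a b => pderiv a (f b)).adjugate i₀ a • pderiv a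

theorem curveDerivation_apply (g : MvPolynomial (Fin m) ℝ) :
    curveDerivation f i₀ g =
      ∑ a, (Matrix.of fun a b => pderiv a (f b)).adjugate i₀ a * pderiv a g := by
  rw [curveDerivation, ← Derivation.coeFnAddMonoidHom_apply, map_sum, Finset.sum_apply]
  rfl

theorem curveDerivation_eq_det (g : MvPolynomial (Fin m) ℝ) :
    curveDerivation f i₀ g =
      Matrix.det (Matrix.of fun a b => pderiv a (Function.update f i₀ g b)) := by
  have h : (Matrix.of fun a b => pderiv a (Function.update f i₀ g b)) =
      (Matrix.of fun a b => pderiv a (f b)).updateCol i₀ (fun a => pderiv a g) := by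
    ext1 a b
    rcases eq_or_ne b i₀ with rfl | hb <;> simp [*]
  rw [h, ← Matrix.cramer_apply, Matrix.cramer_eq_adjugate_mulVec, curveDerivation_apply]
  rfl

theorem curveDerivation_self :
    curveDerivation f i₀ (f i₀) = Matrix.det (Matrix.of fun a b => pderiv a (f b)) := by
  rw [curveDerivation_eq_det, Function.update_eq_self]

theorem curveDerivation_of_ne {b : Fin m} (hb : b ≠ i₀) : curveDerivation f i₀ (f b) = 0 := by
  rw [curveDerivation_eq_det]
  exact Matrix.det_zero_of_column_eq hb fun a => by simp [hb]

/-- The ideal of functions that vanish at `X` to order at least `k` along the curve on which all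
`f b` with `b ≠ i₀` are zero. -/
noncomputable def curveIdeal (k : ℕ) : Ideal (MvPolynomial (Fin m) ℝ) :=
  Ideal.span (f '' {i₀}ᶜ) ⊔ pointIdeal X ^ k

variable {f i₀ X}

theorem curveIdeal_antitone : Antitone (curveIdeal f i₀ X) :=
  fun _ _ h => sup_le_sup_left (Ideal.pow_le_pow_right h) _

theorem mem_curveIdeal_of_ne {b : Fin m} (hb : b ≠ i₀) (k : ℕ) : f b ∈ curveIdeal f i₀ X k :=
  Ideal.mem_sup_left (Ideal.subset_span ⟨b, hb, rfl⟩)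

theorem curveIdeal_zero : curveIdeal f i₀ X 0 = ⊤ := by simp [curveIdeal]

theorem curveIdeal_one (hf : ∀ b, f b ∈ pointIdeal X) : curveIdeal f i₀ X 1 = pointIdeal X := by
  rw [curveIdeal, pow_one, sup_eq_right, Ideal.span_le]
  rintro _ ⟨b, -, rfl⟩
  exact hf b

theorem derivation_mem_pow {R A : Type*} [CommRing R] [CommRing A] [Algebra R A]
    (D : Derivation R A A) (I : Ideal A) (k : ℕ) {g : A} (hg : g ∈ I ^ (k + 1)) : D g ∈ I ^ k := by
  induction k generalizing g with
  | zero => simp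
  | succ k ih =>
    rw [pow_succ] at hg
    induction hg using Submodule.mul_induction_on' with
    | mem_mul_mem a ha b hb =>
      rw [D.leibniz, smul_eq_mul, smul_eq_mul]
      refine add_mem (Ideal.mul_mem_right _ _ ha) ?_
      rw [pow_succ, mul_comm b]
      exact Ideal.mul_mem_mul (ih ha) hb
    | add x _ y _ hx hy => rw [map_add]; exact add_mem hx hy

/-- The derivation kills the equations of the curve, and any derivation lowers a power of an ideal
by at most one. -/
theorem curveDerivation_mem_curveIdeal {k : ℕ} {g : MvPolynomial (Fin m) ℝ}
    (hg : g ∈ curveIdeal f i₀ X (k + 1)) : curveDerivation f i₀ g ∈ curveIdeal f i₀ X k := by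
  obtain ⟨q, hq, p, hp, rfl⟩ := Submodule.mem_sup.1 hg
  clear hg
  rw [map_add]
  refine add_mem (Ideal.mem_sup_left ?_)
    (Ideal.mem_sup_right (derivation_mem_pow _ _ _ hp))
  induction hq using Submodule.span_induction with
  | mem x hx =>
    obtain ⟨b, hb, rfl⟩ := hx
    rw [curveDerivation_of_ne f i₀ hb]; exact zero_mem _
  | zero => simp
  | add x y _ _ hx hy => rw [map_add]; exact add_mem hx hy
  | smul a x hx h =>
    rw [smul_eq_mul, Derivation.leibniz, smul_eq_mul, smul_eq_mul]
    exact add_mem (Ideal.mul_mem_left _ _ h) (Ideal.mul_mem_right _ _ hx)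

/-- A polynomial nonzero at `X` is a unit modulo every power of the maximal ideal. Thus orders can
be compared before localizing. -/
theorem mem_curveIdeal_of_mul_mem {k : ℕ} {h g : MvPolynomial (Fin m) ℝ}
    (hh : h ∉ pointIdeal X) (hg : h * g ∈ curveIdeal f i₀ X k) : g ∈ curveIdeal f i₀ X k := by
  have h1 : IsCoprime (Ideal.span {h}) (pointIdeal X ^ k) := by
    refine IsCoprime.pow_right ?_
    rw [Ideal.isCoprime_iff_sup_eq, sup_comm]
    refine (pointIdeal_isMaximal X).out.2 _ (left_lt_sup.2 ?_)
    simpa [Ideal.span_le] using hh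
  rw [Ideal.isCoprime_iff_exists] at h1
  obtain ⟨x, hx, p, hp, hxp⟩ := h1
  obtain ⟨y, rfl⟩ := Ideal.mem_span_singleton'.1 hx
  have : g = y * (h * g) + g * p := by linear_combination (-g) * hxp
  rw [this]
  exact add_mem (Ideal.mul_mem_left _ _ hg) (Ideal.mem_sup_right (Ideal.mul_mem_left _ _ hp))

/-- `f` is a family of polynomials vanishing at `X` whose Jacobian matrix at `X` is regular. -/
structure IsCoordinateSystem (f : Fin m → MvPolynomial (Fin m) ℝ) (X : Fin m → ℝ) : Prop where
  mem : ∀ b, f b ∈ pointIdeal X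
  det_ne_zero : Matrix.det (Matrix.of fun a b => polyGradient (f b) X a) ≠ 0

namespace IsCoordinateSystem

variable (hf : IsCoordinateSystem f X)
include hf

theorem det_notMem : Matrix.det (Matrix.of fun a b => pderiv a (f b)) ∉ pointIdeal X := by
  rw [mem_pointIdeal, eval_det_pderiv]; exact hf.det_ne_zero

/-- Leading terms: `f i₀` is a local parameter of the curve, so each graded piece of the order
filtration is spanned over `ℝ` by a power of it. -/
theorem pow_sub_mem (i₀ : Fin m) (k : ℕ) {g : MvPolynomial (Fin m) ℝ}
    (hg : g ∈ curveIdeal f i₀ X k) :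
    ∃ r : ℝ, g - C r * f i₀ ^ k ∈ curveIdeal f i₀ X (k + 1) := by
  have hle : ∀ k, pointIdeal X ^ k ≤ Ideal.span {f i₀ ^ k} ⊔ curveIdeal f i₀ X (k + 1) := by
    have hone : pointIdeal X ≤ Ideal.span {f i₀} ⊔ curveIdeal f i₀ X 2 := by
      refine (pointIdeal_le_span_sup_sq hf.det_ne_zero hf.mem).trans (sup_le ?_ ?_)
      · rw [Ideal.span_le]
        rintro _ ⟨b, rfl⟩
        rcases eq_or_ne b i₀ with rfl | hb
        · exact Ideal.mem_sup_left (Ideal.mem_span_singleton_self _)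
        · exact Ideal.mem_sup_right (mem_curveIdeal_of_ne hb _)
      · exact le_sup_right.trans le_sup_right
    intro k
    induction k with
    | zero => simp
    | succ k ih =>
      rw [pow_succ, Ideal.mul_le]
      intro p hp q hq
      obtain ⟨p₁, hp₁, p₂, hp₂, rfl⟩ := Submodule.mem_sup.1 (ih hp)
      obtain ⟨y, rfl⟩ := Ideal.mem_span_singleton'.1 hp₁
      have h2 : p₂ * q ∈ curveIdeal f i₀ X (k + 1 + 1) := by
        obtain ⟨a, ha, b, hb, rfl⟩ := Submodule.mem_sup.1 hp₂
        rw [add_mul]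
        refine add_mem (Ideal.mem_sup_left (Ideal.mul_mem_right _ _ ha)) (Ideal.mem_sup_right ?_)
        rw [pow_succ]
        exact Ideal.mul_mem_mul hb hq
      obtain ⟨q₁, hq₁, q₂, hq₂, rfl⟩ := Submodule.mem_sup.1 (hone hq)
      obtain ⟨z, rfl⟩ := Ideal.mem_span_singleton'.1 hq₁
      have h3 : f i₀ ^ k * q₂ ∈ curveIdeal f i₀ X (k + 1 + 1) := by
        obtain ⟨a, ha, b, hb, rfl⟩ := Submodule.mem_sup.1 hq₂
        rw [mul_add]
        refine add_mem (Ideal.mem_sup_left (Ideal.mul_mem_left _ _ ha)) (Ideal.mem_sup_right ?_)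
        rw [add_assoc, pow_add]
        exact Ideal.mul_mem_mul (Ideal.pow_mem_pow (hf.mem _) _) hb
      have h4 : y * z * f i₀ ^ (k + 1) ∈ Ideal.span {f i₀ ^ (k + 1)} :=
        Ideal.mul_mem_left _ _ (Ideal.mem_span_singleton_self _)
      have := Submodule.add_mem_sup h4 (add_mem (Ideal.mul_mem_left _ y h3) h2)
      convert this using 1
      ring
  obtain ⟨q, hq, p, hp, rfl⟩ := Submodule.mem_sup.1 hg
  obtain ⟨p₁, hp₁, p₂, hp₂, rfl⟩ := Submodule.mem_sup.1 (hle k hp)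
  obtain ⟨y, rfl⟩ := Ideal.mem_span_singleton'.1 hp₁
  refine ⟨eval X y, ?_⟩
  have h1 : (y - C (eval X y)) * f i₀ ^ k ∈ pointIdeal X ^ (k + 1) := by
    rw [pow_succ']
    exact Ideal.mul_mem_mul (by simp [mem_pointIdeal]) (Ideal.pow_mem_pow (hf.mem _) _)
  have : q + p₂ + (y - C (eval X y)) * f i₀ ^ k ∈ curveIdeal f i₀ X (k + 1) :=
    add_mem (add_mem (Ideal.mem_sup_left hq) hp₂) (Ideal.mem_sup_right h1)
  convert this using 1
  ring

/-- Differentiating `f i₀ ^ (k + 1)` gives `(k + 1) * f i₀ ^ k` times the Jacobian determinant, a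
unit at `X`; this drives the induction. -/
theorem pow_notMem (i₀ : Fin m) (k : ℕ) : f i₀ ^ k ∉ curveIdeal f i₀ X (k + 1) := by
  induction k with
  | zero =>
    rw [zero_add, curveIdeal_one hf.mem, pow_zero, mem_pointIdeal]
    simp
  | succ k ih =>
    intro h
    have h1 := curveDerivation_mem_curveIdeal h
    rw [Derivation.leibniz_pow, Nat.add_sub_cancel, smul_eq_mul, curveDerivation_self] at h1
    refine ih (mem_curveIdeal_of_mul_mem (X := X)
      (h := C ((k : ℝ) + 1) * Matrix.det (Matrix.of fun a b => pderiv a (f b))) ?_ ?_)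
    · refine fun hmem => (Ideal.IsPrime.mem_or_mem inferInstance hmem).elim (fun h => ?_)
        hf.det_notMem
      rw [mem_pointIdeal, eval_C] at h
      exact absurd h (by positivity)
    · convert h1 using 1
      rw [nsmul_eq_mul]
      simp
      ring

/-- In characteristic zero the leading term `r * f i₀ ^ (k + 1)` has a derivative of order exactly
`k`. -/
theorem curveDerivation_notMem (i₀ : Fin m) {k : ℕ} {g : MvPolynomial (Fin m) ℝ}
    (hg : g ∈ curveIdeal f i₀ X (k + 1)) (hg' : g ∉ curveIdeal f i₀ X (k + 2)) :
    curveDerivation f i₀ g ∉ curveIdeal f i₀ X (k + 1) := by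
  obtain ⟨r, hr⟩ := hf.pow_sub_mem i₀ _ hg
  have hr0 : r ≠ 0 := by
    rintro rfl
    exact hg' (by simpa using hr)
  intro h
  have h1 := sub_mem h (curveDerivation_mem_curveIdeal hr)
  rw [← map_sub, sub_sub_cancel, ← smul_eq_C_mul, Derivation.map_smul, Derivation.leibniz_pow,
    Nat.add_sub_cancel, smul_eq_mul, curveDerivation_self] at h1
  refine hf.pow_notMem i₀ k (mem_curveIdeal_of_mul_mem (X := X)
    (h := C (r * ((k : ℝ) + 1)) * Matrix.det (Matrix.of fun a b => pderiv a (f b))) ?_ ?_)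
  · refine fun hmem => (Ideal.IsPrime.mem_or_mem inferInstance hmem).elim (fun h => ?_)
      hf.det_notMem
    rw [mem_pointIdeal, eval_C] at h
    exact mul_ne_zero hr0 (by positivity) h
  · convert h1 using 1
    rw [nsmul_eq_mul, smul_eq_C_mul]
    simp
    ring

/-- The tangent field `v` of the curve pairs with each column of `P` to an element of order at least
`k`. Multiplying by the adjugate of `P` carries this over to `v a * P.det`, and some `v a` is a unit
at `X`. -/
theorem gradientMinors_le_curveIdeal (i₀ : Fin m) {k : ℕ} {G : Set (MvPolynomial (Fin m) ℝ)}
    (hG : G ⊆ curveIdeal f i₀ X (k + 1)) : gradientMinors G ≤ curveIdeal f i₀ X k := by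
  rw [gradientMinors, Ideal.span_le]
  rintro _ ⟨g, hg, rfl⟩
  set v := (Matrix.of fun a b => pderiv a (f b)).adjugate i₀
  set P := Matrix.of fun a b => pderiv a (g b)
  have hv : ∀ b, (v ᵥ* P) b ∈ curveIdeal f i₀ X k := fun b => by
    have := curveDerivation_mem_curveIdeal (hG (hg b))
    rwa [curveDerivation_apply] at this
  have hdet : ∀ a, v a * P.det ∈ curveIdeal f i₀ X k := fun a => by
    have h1 : (v ᵥ* P) ᵥ* P.adjugate = P.det • v := by
      rw [Matrix.vecMul_vecMul, Matrix.mul_adjugate, Matrix.vecMul_smul, Matrix.vecMul_one]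
    have h2 := congrFun h1 a
    rw [Pi.smul_apply, smul_eq_mul] at h2
    rw [mul_comm, ← h2, Matrix.vecMul, dotProduct]
    exact Ideal.sum_mem _ fun b _ => Ideal.mul_mem_right _ _ (hv b)
  obtain ⟨a, ha⟩ : ∃ a, v a ∉ pointIdeal X := by
    by_contra! h
    apply hf.det_notMem
    rw [← curveDerivation_self f i₀, curveDerivation_apply]
    exact Ideal.sum_mem _ fun a _ => Ideal.mul_mem_right _ _ (h a)
  exact mem_curveIdeal_of_mul_mem ha (hdet a)

omit hf in
theorem curveDerivation_mem_gradientMinors {G : Set (MvPolynomial (Fin m) ℝ)}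
    (hG : ∀ b ≠ i₀, f b ∈ G) {g : MvPolynomial (Fin m) ℝ} (hg : g ∈ G) :
    curveDerivation f i₀ g ∈ gradientMinors G := by
  refine Ideal.subset_span ⟨Function.update f i₀ g, fun b => ?_, curveDerivation_eq_det f i₀ g⟩
  rcases eq_or_ne b i₀ with rfl | hb
  · simpa
  · simpa [hb] using hG b hb

end IsCoordinateSystem

end Curve

/-! ### Order of the shakiness ideals along the curve -/

namespace Framework

variable {d w m : ℕ} (F : Framework d w m) {X : Fin m → ℝ} {f : Fin m → MvPolynomial (Fin m) ℝ}
  {i₀ : Fin m}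

theorem shakyIdeal_le_curveIdeal (hf : IsCoordinateSystem f X) {j k : ℕ}
    (hc : F.constraints X ⊆ curveIdeal f i₀ X (k + j)) :
    F.shakyIdeal j ≤ curveIdeal f i₀ X k := by
  induction j generalizing k with
  | zero => simp [shakyIdeal]
  | succ j ih =>
    have h1 : F.shakyIdeal j ≤ curveIdeal f i₀ X (k + 1) := ih (by convert hc using 2; ring_nf)
    rw [F.shakyIdeal_succ X, sup_le_iff]
    exact ⟨h1.trans (curveIdeal_antitone (Nat.le_succ k)),
      hf.gradientMinors_le_curveIdeal i₀ (Set.union_subset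
        (hc.trans (curveIdeal_antitone (by omega))) h1)⟩

/-- The drop of one order per step is attained: differentiating an element of minimal order along
the curve is one of the new minors. -/
theorem exists_mem_shakyIdeal_notMem_curveIdeal (hf : IsCoordinateSystem f X)
    (hfc : ∀ b ≠ i₀, f b ∈ F.constraints X) {j k : ℕ}
    (hc : F.constraints X ⊆ curveIdeal f i₀ X (k + j))
    (hc' : ¬ F.constraints X ⊆ curveIdeal f i₀ X (k + j + 1)) :
    ∃ g ∈ F.constraints X ∪ F.shakyIdeal j, g ∉ curveIdeal f i₀ X (k + 1) := by
  induction j generalizing k with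
  | zero =>
    obtain ⟨g, hg, hg'⟩ := Set.not_subset.1 hc'
    exact ⟨g, Or.inl hg, hg'⟩
  | succ j ih =>
    have hc1 : F.constraints X ⊆ curveIdeal f i₀ X (k + 1 + j) := by convert hc using 2; ring_nf
    obtain ⟨g, hg, hg'⟩ := ih hc1 (by convert hc' using 3; ring_nf)
    have hle := F.shakyIdeal_le_curveIdeal hf hc1
    have hg1 : g ∈ curveIdeal f i₀ X (k + 1) := by
      rcases hg with hg | hg
      · exact curveIdeal_antitone (by omega) (hc hg)
      · exact hle hg
    refine ⟨curveDerivation f i₀ g, Or.inr ?_, hf.curveDerivation_notMem i₀ hg1 hg'⟩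
    rw [F.shakyIdeal_succ X]
    exact Ideal.mem_sup_right (IsCoordinateSystem.curveDerivation_mem_gradientMinors
      (fun b hb => Or.inl (hfc b hb)) hg)

theorem shakyIdeal_le_pointIdeal_iff (hX : X ∈ F.configurations) (hf : IsCoordinateSystem f X)
    (hfc : ∀ b ≠ i₀, f b ∈ F.constraints X) (j : ℕ) :
    F.shakyIdeal j ≤ pointIdeal X ↔ F.constraints X ⊆ curveIdeal f i₀ X (j + 1) := by
  refine ⟨fun h => ?_, fun h => ?_⟩
  · induction j with
    | zero =>
      rw [zero_add, curveIdeal_one hf.mem]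
      exact F.constraints_subset_pointIdeal hX
    | succ j ih =>
      by_contra hc
      have h1 := ih ((F.shakyIdeal_mono (Nat.le_succ j)).trans h)
      -- With `k = 0` the lemma yields an element that does not vanish at `X`.
      obtain ⟨g, hg, hg'⟩ := F.exists_mem_shakyIdeal_notMem_curveIdeal (k := 0) (j := j + 1) hf hfc
        (by simpa using h1) (by simpa using hc)
      rw [zero_add, curveIdeal_one hf.mem] at hg'
      exact hg' (hg.elim (fun hg => F.constraints_subset_pointIdeal hX hg) fun hg => h hg)
  · rw [← curveIdeal_one (i₀ := i₀) hf.mem]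
    exact F.shakyIdeal_le_curveIdeal hf (by rwa [add_comm])

end Framework

/-! ### Multiplicity as order along the curve -/

theorem length_quotient_eq_add_one_of_covBy {R M : Type*} [Ring R] [AddCommGroup M] [Module R M]
    {I J : Submodule R M} (h : I ⋖ J) :
    Module.length R (M ⧸ I) = Module.length R (M ⧸ J) + 1 := by
  have hatom : IsAtom (J.map I.mkQ) := by
    refine ⟨fun h0 => h.lt.not_ge ?_, fun b hb => ?_⟩
    · simpa using LinearMap.le_ker_iff_map.2 h0
    · have h1 : I ≤ b.comap I.mkQ := Submodule.le_comap_mkQ _ _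
      have h2 : b.comap I.mkQ < J := by
        have h3 : (b.comap I.mkQ).map I.mkQ = b :=
          Submodule.map_comap_eq_of_surjective (Submodule.mkQ_surjective I) b
        have h4 : (J.map I.mkQ).comap I.mkQ = J := by
          rw [Submodule.comap_map_mkQ, sup_eq_right.2 h.le]
        refine lt_of_le_of_ne ?_ fun he => hb.ne (by rw [← h3, he])
        rw [← h4]
        exact Submodule.comap_mono hb.le
      rcases h1.eq_or_lt with h3 | h3
      · rw [← Submodule.map_comap_eq_of_surjective (Submodule.mkQ_surjective I) b, ← h3,
          Submodule.mkQ_map_self]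
      · exact absurd h2 (h.2 h3)
  have := isSimpleModule_iff_isAtom.2 hatom
  rw [Module.length_eq_add_of_exact (J.map I.mkQ).subtype (J.map I.mkQ).mkQ
    (Submodule.subtype_injective _) (Submodule.mkQ_surjective _)
    (LinearMap.exact_subtype_mkQ _), Module.length_eq_one,
    (Submodule.quotientQuotientEquivQuotient I J h.le).length_eq, add_comm]

section Length

variable {m : ℕ} {X : Fin m → ℝ} {f : Fin m → MvPolynomial (Fin m) ℝ} {i₀ : Fin m}
  {A : Set (MvPolynomial (Fin m) ℝ)}

theorem algebraMap_mem_map_curveIdeal_iff {k : ℕ} {g : MvPolynomial (Fin m) ℝ} :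
    algebraMap _ (Localization.AtPrime (pointIdeal X)) g ∈
      (curveIdeal f i₀ X k).map (algebraMap _ (Localization.AtPrime (pointIdeal X))) ↔
      g ∈ curveIdeal f i₀ X k := by
  rw [IsLocalization.algebraMap_mem_map_algebraMap_iff (pointIdeal X).primeCompl]
  exact ⟨fun ⟨h, hh, hg⟩ => mem_curveIdeal_of_mul_mem hh hg,
    fun hg => ⟨1, one_mem _, by simpa using hg⟩⟩

/-- An ideal strictly above the smaller one contains an element with nonzero leading coefficient,
hence the image of `f i₀ ^ k`, hence everything of order `k`. -/
theorem IsCoordinateSystem.map_curveIdeal_covBy (hf : IsCoordinateSystem f X) (i₀ : Fin m)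
    (k : ℕ) :
    (curveIdeal f i₀ X (k + 1)).map (algebraMap _ (Localization.AtPrime (pointIdeal X))) ⋖
      (curveIdeal f i₀ X k).map (algebraMap _ (Localization.AtPrime (pointIdeal X))) := by
  have hk : f i₀ ^ k ∈ curveIdeal f i₀ X k :=
    Ideal.mem_sup_right (Ideal.pow_mem_pow (hf.mem _) _)
  refine ⟨lt_of_le_of_ne (Ideal.map_mono (curveIdeal_antitone (Nat.le_succ k))) fun h => ?_,
    fun I hI hI' => ?_⟩
  · refine hf.pow_notMem i₀ k ?_
    rw [← algebraMap_mem_map_curveIdeal_iff, h, algebraMap_mem_map_curveIdeal_iff]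
    exact hk
  · obtain ⟨y, hyI, hy⟩ := SetLike.exists_of_lt hI
    obtain ⟨g, s, rfl⟩ := IsLocalization.exists_mk'_eq (pointIdeal X).primeCompl y
    have hs := IsLocalization.map_units (Localization.AtPrime (pointIdeal X)) s
    have hmem : ∀ I : Ideal (Localization.AtPrime (pointIdeal X)),
        IsLocalization.mk' _ g s ∈ I ↔ algebraMap _ _ g ∈ I := fun I => by
      rw [← IsLocalization.mk'_spec' _ g s, Ideal.unit_mul_mem_iff_mem _ hs]
    have hgk := hI'.le hyI
    rw [hmem, algebraMap_mem_map_curveIdeal_iff] at hgk hy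
    rw [hmem] at hyI
    obtain ⟨r, hr⟩ := hf.pow_sub_mem i₀ k hgk
    have hr0 : r ≠ 0 := by
      rintro rfl
      exact hy (by simpa using hr)
    have htI : algebraMap (MvPolynomial (Fin m) ℝ) _ (f i₀ ^ k) ∈ I := by
      have h1 := sub_mem hyI (hI.le (Ideal.mem_map_of_mem _ hr))
      rw [← map_sub, sub_sub_cancel] at h1
      have h2 := I.mul_mem_left (algebraMap (MvPolynomial (Fin m) ℝ) _ (C r⁻¹)) h1
      rwa [← map_mul, ← mul_assoc, ← C_mul, inv_mul_cancel₀ hr0, C_1, one_mul] at h2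
    refine hI'.not_ge (Ideal.map_le_iff_le_comap.2 fun x hx => ?_)
    obtain ⟨r', hr'⟩ := hf.pow_sub_mem i₀ k hx
    have h1 := add_mem (hI.le (Ideal.mem_map_of_mem _ hr'))
      (I.mul_mem_left (algebraMap (MvPolynomial (Fin m) ℝ) _ (C r')) htI)
    rw [← map_mul, ← map_add, sub_add_cancel] at h1
    exact h1

theorem IsCoordinateSystem.length_quotient_curveIdeal (hf : IsCoordinateSystem f X) (i₀ : Fin m)
    (k : ℕ) :
    Module.length (Localization.AtPrime (pointIdeal X)) (Localization.AtPrime (pointIdeal X) ⧸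
      (curveIdeal f i₀ X k).map (algebraMap _ (Localization.AtPrime (pointIdeal X)))) = k := by
  induction k with
  | zero =>
    rw [curveIdeal_zero, Ideal.map_top, Nat.cast_zero, Module.length_eq_zero_iff]
    exact Ideal.Quotient.subsingleton_iff.2 rfl
  | succ k ih =>
    rw [length_quotient_eq_add_one_of_covBy (hf.map_curveIdeal_covBy i₀ k), ih, Nat.cast_succ]

theorem map_pointIdeal (X : Fin m → ℝ) :
    (pointIdeal X).map (algebraMap _ (Localization.AtPrime (pointIdeal X))) =
      IsLocalRing.maximalIdeal (Localization.AtPrime (pointIdeal X)) :=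
  IsLocalization.AtPrime.map_eq_maximalIdeal _ _

theorem IsCoordinateSystem.solutionMultiplicity_eq (hf : IsCoordinateSystem f X)
    (hfA : ∀ b ≠ i₀, f b ∈ A) {k : ℕ} (hA : A ⊆ curveIdeal f i₀ X k)
    (hA' : ¬ A ⊆ curveIdeal f i₀ X (k + 1)) : solutionMultiplicity A X = k := by
  suffices h : (Ideal.span A).map (algebraMap _ (Localization.AtPrime (pointIdeal X))) =
      (curveIdeal f i₀ X k).map (algebraMap _ (Localization.AtPrime (pointIdeal X))) by
    rw [solutionMultiplicity, h, hf.length_quotient_curveIdeal]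
  refine le_antisymm (Ideal.map_mono (Ideal.span_le.2 hA)) ?_
  -- An element of `A` of order exactly `k` cancels leading terms; the remainder has order `k + 1`.
  -- Nakayama's lemma then gives equality in the local ring.
  have hle : curveIdeal f i₀ X k ≤ Ideal.span A ⊔ pointIdeal X * curveIdeal f i₀ X k := by
    intro x hx
    obtain ⟨g, hg, hg'⟩ := Set.not_subset.1 hA'
    obtain ⟨r, hr⟩ := hf.pow_sub_mem i₀ k (hA hg)
    obtain ⟨r', hr'⟩ := hf.pow_sub_mem i₀ k hx
    have hr0 : r ≠ 0 := by
      rintro rfl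
      exact hg' (by simpa using hr)
    have h1 : x - C (r' / r) * g ∈ curveIdeal f i₀ X (k + 1) := by
      convert sub_mem hr' (Ideal.mul_mem_left _ (C (r' / r)) hr) using 1
      have : C (σ := Fin m) r' = C (r' / r) * C r := by rw [← C_mul, div_mul_cancel₀ _ hr0]
      rw [this]
      ring
    have h2 : curveIdeal f i₀ X (k + 1) ≤
        Ideal.span A ⊔ pointIdeal X * curveIdeal f i₀ X k := by
      refine sup_le_sup (Ideal.span_mono ?_) ?_
      · rintro _ ⟨b, hb, rfl⟩
        exact hfA b hb
      · rw [pow_succ']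
        exact Ideal.mul_mono_right le_sup_right
    have := add_mem (h2 h1) (Ideal.mem_sup_left
      (Ideal.mul_mem_left _ (C (r' / r)) (Ideal.subset_span hg)))
    rwa [sub_add_cancel] at this
  refine Submodule.le_of_le_smul_of_le_jacobson_bot
    (I := IsLocalRing.maximalIdeal (Localization.AtPrime (pointIdeal X)))
    (IsNoetherian.noetherian _) (IsLocalRing.maximalIdeal_le_jacobson _) ?_
  rw [smul_eq_mul, ← map_pointIdeal, ← Ideal.map_mul, ← Ideal.map_sup]
  exact Ideal.map_mono hle

theorem IsCoordinateSystem.solutionMultiplicity_eq_add_one_iff (hf : IsCoordinateSystem f X)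
    (hfA : ∀ b ≠ i₀, f b ∈ A) (n : ℕ) :
    solutionMultiplicity A X = (n : ℕ∞) + 1 ↔
      A ⊆ curveIdeal f i₀ X (n + 1) ∧ ¬ A ⊆ curveIdeal f i₀ X (n + 2) := by
  refine ⟨fun h => ?_, fun h => by exact_mod_cast hf.solutionMultiplicity_eq hfA h.1 h.2⟩
  -- If `A` vanished to every order along the curve, the quotient would surject onto one of length
  -- `n + 2`.
  have hex : ∃ k, ¬ A ⊆ curveIdeal f i₀ X (k + 1) := by
    by_contra! hA
    have hle := Module.length_le_of_surjective (Submodule.factor (Ideal.map_mono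
      (f := algebraMap _ (Localization.AtPrime (pointIdeal X)))
      (Ideal.span_le.2 (hA (n + 1))))) (Submodule.factor_surjective _)
    rw [hf.length_quotient_curveIdeal] at hle
    rw [solutionMultiplicity] at h
    rw [h] at hle
    have : n + 1 + 1 ≤ n + 1 := by exact_mod_cast hle
    omega
  classical
  have hmin : A ⊆ curveIdeal f i₀ X (Nat.find hex) := by
    rcases Nat.eq_zero_or_pos (Nat.find hex) with h0 | h0
    · rw [h0, curveIdeal_zero]; exact Set.subset_univ _
    · have := Nat.find_min hex (m := Nat.find hex - 1) (by omega)
      rwa [not_not, Nat.sub_add_cancel h0] at this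
  have h1 := hf.solutionMultiplicity_eq hfA hmin (Nat.find_spec hex)
  rw [h] at h1
  have h2 : n + 1 = Nat.find hex := by exact_mod_cast h1
  have h3 := Nat.find_spec hex
  rw [← h2] at hmin h3
  exact ⟨hmin, h3⟩

theorem solutionMultiplicity_eq_one_iff :
    solutionMultiplicity A X = 1 ↔
      (Ideal.span A).map (algebraMap _ (Localization.AtPrime (pointIdeal X))) =
        IsLocalRing.maximalIdeal (Localization.AtPrime (pointIdeal X)) := by
  rw [solutionMultiplicity, Module.length_eq_one_iff, isSimpleModule_iff_isCoatom,
    ← Ideal.isMaximal_def]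
  exact ⟨fun h => IsLocalRing.eq_maximalIdeal h, fun h => h ▸ inferInstance⟩

/-- Multiplicity one means that `A` generates the maximal ideal locally. But `v` annihilates the
differentials of the whole ideal of `A`, and not those of all coordinates. -/
theorem solutionMultiplicity_ne_one (hA : A ⊆ pointIdeal X) {v : Fin m → ℝ} (hv : v ≠ 0)
    (hAv : ∀ g ∈ A, polyGradient g X ⬝ᵥ v = 0) : solutionMultiplicity A X ≠ 1 := by
  rw [Ne, solutionMultiplicity_eq_one_iff, ← map_pointIdeal]
  intro h
  have hspan : ∀ g ∈ Ideal.span A, eval X g = 0 ∧ polyGradient g X ⬝ᵥ v = 0 := by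
    intro g hg
    induction hg using Submodule.span_induction with
    | mem x hx => exact ⟨hA hx, hAv x hx⟩
    | zero => simp [polyGradient_zero]
    | add x y _ _ hx hy => simp [polyGradient_add, add_dotProduct, hx, hy]
    | smul a x _ hx => simp [polyGradient_mul, smul_dotProduct, hx]
  refine hv (funext fun a => ?_)
  have hmem : algebraMap _ (Localization.AtPrime (pointIdeal X)) (MvPolynomial.X a - C (X a)) ∈
      (pointIdeal X).map (algebraMap _ (Localization.AtPrime (pointIdeal X))) :=
    Ideal.mem_map_of_mem _ (by simp [mem_pointIdeal])
  rw [← h, IsLocalization.algebraMap_mem_map_algebraMap_iff (pointIdeal X).primeCompl] at hmem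
  obtain ⟨s, hs, hsg⟩ := hmem
  have := (hspan _ hsg).2
  rw [polyGradient_mul, polyGradient_X_sub_C] at this
  simp only [map_sub, eval_X, eval_C, sub_self, zero_smul, add_zero, smul_dotProduct,
    single_one_dotProduct, smul_eq_mul] at this
  exact (mul_eq_zero.1 this).resolve_left hs

end Length

/-! ### Vanishing minors exclude finite multiplicity -/

theorem Derivation.eq_zero_of_isIntegral {B A M : Type*} [CommRing B] [IsDomain B] [CommRing A]
    [IsDomain A] [CharZero A] [Algebra B A] [FaithfulSMul B A] [AddCommGroup M] [Module A M]
    [Module B M] [IsScalarTower B A M] [Module.IsTorsionFree A M] (D : Derivation B A M) {x : A}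
    (hx : IsIntegral B x) : D x = 0 := by
  have hinj : Function.Injective (algebraMap B A) := FaithfulSMul.algebraMap_injective B A
  have : CharZero B := ⟨fun a b h => by
    have := congrArg (algebraMap B A) h
    simpa using this⟩
  suffices h : ∀ n, ∀ P : Polynomial B, P.natDegree ≤ n → P ≠ 0 → Polynomial.aeval x P = 0 →
      D x = 0 by
    obtain ⟨P, hP, hPx⟩ := hx
    exact h _ P le_rfl hP.ne_zero hPx
  intro n
  induction n with
  | zero =>
    intro P hn hP hPx
    rw [Polynomial.eq_C_of_natDegree_le_zero hn, Polynomial.aeval_C, map_eq_zero_iff _ hinj] at hPx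
    rw [Polynomial.eq_C_of_natDegree_le_zero hn, hPx, Polynomial.C_0] at hP
    exact absurd rfl hP
  | succ n ih =>
    intro P hn hP hPx
    have h1 := D.map_aeval P x
    rw [hPx, map_zero, eq_comm, smul_eq_zero] at h1
    -- From `P'(x) • D x = 0`, either `D x = 0` or `x` is a root of `P'`, which has smaller degree
    -- and is nonzero in characteristic zero unless `P` is constant.
    refine h1.elim (fun h1 => ?_) id
    by_cases h0 : P.natDegree = 0
    · exact ih P (by omega) hP hPx
    · refine ih P.derivative ?_ ?_ h1
      · have := Polynomial.natDegree_derivative_lt h0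
        omega
      · exact fun h => h0 (Polynomial.derivative_eq_zero.1 h)

theorem quasiFinite_of_finite (R S : Type*) [CommRing R] [CommRing S] [Algebra R S]
    [Module.Finite R S] : Algebra.QuasiFinite R S := inferInstance

section

variable {m : ℕ}

theorem mkDerivation_eq_sum {M : Type*} [AddCommGroup M] [Module (MvPolynomial (Fin m) ℝ) M]
    [Module ℝ M] [IsScalarTower ℝ (MvPolynomial (Fin m) ℝ) M] (v : Fin m → M)
    (g : MvPolynomial (Fin m) ℝ) : mkDerivation ℝ v g = ∑ a, pderiv a g • v a := by
  induction g using MvPolynomial.induction_on with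
  | C r => simp
  | add p q hp hq => simp [hp, hq, add_smul, Finset.sum_add_distrib]
  | mul_X p b hp =>
    simp only [Derivation.leibniz, hp, mkDerivation_X, smul_eq_mul, pderiv_X, add_smul,
      Finset.sum_add_distrib, Finset.smul_sum, mul_smul]
    congr 1
    rw [Finset.sum_eq_single b]
    · simp
    · intro a _ hab
      simp [Pi.single_eq_of_ne hab.symm]
    · simp

theorem algebraMap_residueField_surjective (X : Fin m → ℝ) :
    Function.Surjective (algebraMap (IsLocalRing.ResidueField ℝ)
      (IsLocalRing.ResidueField (Localization.AtPrime (pointIdeal X)))) := by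
  intro x
  obtain ⟨y, rfl⟩ := IsLocalRing.residue_surjective x
  obtain ⟨g, s, rfl⟩ := IsLocalization.exists_mk'_eq (pointIdeal X).primeCompl y
  have hs : eval X s.1 ≠ 0 := s.2
  have hu := IsLocalization.map_units (Localization.AtPrime (pointIdeal X)) s
  refine ⟨IsLocalRing.residue ℝ (eval X g / eval X s.1), ?_⟩
  change IsLocalRing.residue _ (algebraMap ℝ _ (eval X g / eval X s.1)) = _
  rw [← sub_eq_zero, ← map_sub, IsLocalRing.residue_eq_zero_iff,
    ← Ideal.unit_mul_mem_iff_mem _ hu, mul_sub, IsLocalization.mk'_spec',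
    IsScalarTower.algebraMap_apply ℝ (MvPolynomial (Fin m) ℝ), ← map_mul, ← map_sub,
    ← map_pointIdeal]
  refine Ideal.mem_map_of_mem _ ?_
  rw [mem_pointIdeal, map_sub, map_mul, algebraMap_eq, eval_C, mul_div_cancel₀ _ hs, sub_self]

/-- The residue field at the real point `X` is `ℝ`, so length over the local ring equals length over
`ℝ`. -/
theorem finite_of_length_ne_top (X : Fin m → ℝ) (M : Type*) [AddCommGroup M]
    [Module (Localization.AtPrime (pointIdeal X)) M] [Module ℝ M]
    [IsScalarTower ℝ (Localization.AtPrime (pointIdeal X)) M]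
    (h : Module.length (Localization.AtPrime (pointIdeal X)) M ≠ ⊤) : Module.Finite ℝ M := by
  have h1 := IsLocalRing.length_restrictScalars ℝ (Localization.AtPrime (pointIdeal X)) M
  rw [Module.length_eq_of_surjective (M := IsLocalRing.ResidueField
      (Localization.AtPrime (pointIdeal X))) (algebraMap_residueField_surjective X),
    Module.length_eq_one (IsLocalRing.ResidueField (Localization.AtPrime (pointIdeal X))),
    mul_one] at h1
  rw [← h1, Module.length_ne_top_iff, isFiniteLength_iff_isNoetherian_isArtinian] at h
  have := h.1
  infer_instance

/-- Finite multiplicity makes the fibre over `Spec B` finite at `X`, which is the quasi-finiteness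
needed for Zariski's main theorem. -/
theorem zariskisMainProperty_of_solutionMultiplicity_ne_top {X : Fin m → ℝ}
    {A : Set (MvPolynomial (Fin m) ℝ)} {B : Type*} [CommRing B] [Algebra ℝ B]
    [Algebra B (MvPolynomial (Fin m) ℝ)] [IsScalarTower ℝ B (MvPolynomial (Fin m) ℝ)]
    [Algebra.FiniteType B (MvPolynomial (Fin m) ℝ)] (hA : A ⊆ pointIdeal X)
    (hAB : ∀ c ∈ A, ∃ b, algebraMap B (MvPolynomial (Fin m) ℝ) b = c)
    (h : solutionMultiplicity A X ≠ ⊤) : Algebra.ZariskisMainProperty B (pointIdeal X) := by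
  let R := Localization.AtPrime (pointIdeal X)
  have : IsScalarTower ℝ B R := .to₁₂₄ ℝ B (MvPolynomial (Fin m) ℝ) R
  have hfin : Module.Finite ℝ (R ⧸ (Ideal.span A).map (algebraMap _ R)) :=
    finite_of_length_ne_top X _ h
  have hle : (Ideal.span A).map (algebraMap _ R) ≤
      ((pointIdeal X).under B).map (algebraMap B R) := by
    rw [Ideal.map_span, Ideal.span_le]
    rintro _ ⟨c, hc, rfl⟩
    obtain ⟨b, rfl⟩ := hAB c hc
    rw [← IsScalarTower.algebraMap_apply]
    exact Ideal.mem_map_of_mem (algebraMap B R) (hA hc)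
  have : Module.Finite ℝ (R ⧸ ((pointIdeal X).under B).map (algebraMap B R)) :=
    Module.Finite.of_surjective ((Submodule.factor hle).restrictScalars ℝ)
      (Submodule.factor_surjective hle)
  have : Module.Finite B (R ⧸ ((pointIdeal X).under B).map (algebraMap B R)) :=
    Module.Finite.of_restrictScalars_finite ℝ B _
  have : Algebra.WeaklyQuasiFiniteAt B (pointIdeal X) :=
    (Algebra.weaklyQuasiFiniteAt_iff (pointIdeal X)).2 (quasiFinite_of_finite _ _)
  exact Algebra.ZariskisMainProperty.of_finiteType_of_weaklyQuasiFiniteAt (pointIdeal X)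

theorem exists_minor_ne_zero_of_solutionMultiplicity_ne_top {X : Fin m → ℝ}
    {A : Set (MvPolynomial (Fin m) ℝ)} (hA : A ⊆ pointIdeal X)
    (h : solutionMultiplicity A X ≠ ⊤) : gradientMinors A ≠ ⊥ := by
  intro hminors
  let S := MvPolynomial (Fin m) ℝ
  let K := FractionRing S
  -- Over the fraction field, vanishing minors give a nonzero vector field annihilating all
  -- constraints.
  obtain ⟨v, hv, hAv⟩ := (forall_det_eq_zero_iff_exists_dotProduct_eq_zero
    ((fun g a => algebraMap S K (pderiv a g)) '' A)).1 (by
      intro f hf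
      choose p hp hpf using hf
      have h1 : Matrix.det (Matrix.of fun a b => pderiv a (p b)) = 0 := by
        rw [← Ideal.mem_bot, ← hminors]
        exact Ideal.subset_span ⟨p, hp, rfl⟩
      have h2 := congrArg (algebraMap S K) h1
      rw [RingHom.map_det, map_zero] at h2
      rw [← h2]
      congr 1
      ext a b
      simp [← hpf])
  simp only [Set.forall_mem_image] at hAv
  let D : Derivation ℝ S K := mkDerivation ℝ v
  let B := Algebra.adjoin ℝ A
  have hDB : ∀ b ∈ B, D b = 0 := fun b hb => by
    refine Derivation.eqOn_adjoin (D1 := D) (D2 := 0) (fun c hc => ?_) hb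
    rw [mkDerivation_eq_sum, Derivation.zero_apply, ← hAv hc, dotProduct]
    exact Finset.sum_congr rfl fun a _ => Algebra.smul_def _ _
  let D' : Derivation B S K := Derivation.mk'
    { toFun := D
      map_add' := map_add D
      map_smul' := fun b x => by
        rw [Algebra.smul_def, Derivation.leibniz]
        change (b : S) • D x + x • D b = (b : S) • D x
        rw [hDB b b.2, smul_zero, add_zero] } fun x y => D.leibniz x y
  have : Algebra.FiniteType B S := Algebra.FiniteType.of_restrictScalars_finiteType ℝ B S
  obtain ⟨r, hr, hrint, hint⟩ := Algebra.zariskisMainProperty_iff.1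
    (zariskisMainProperty_of_solutionMultiplicity_ne_top (B := B) hA
      (fun c hc => ⟨⟨c, Algebra.subset_adjoin hc⟩, rfl⟩) h)
  have hr0 : r ≠ 0 := fun h0 => hr (h0 ▸ zero_mem _)
  -- Both `r` and `r ^ k * x` are integral over `B`, so the derivation kills them and therefore `x`.
  have hD' : ∀ x, D' x = 0 := by
    intro x
    obtain ⟨k, hk⟩ := hint x
    have h1 := D'.eq_zero_of_isIntegral hk
    rw [Derivation.leibniz, D'.eq_zero_of_isIntegral (hrint.pow k), smul_zero, add_zero,
      smul_eq_zero] at h1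
    exact h1.resolve_left (pow_ne_zero _ hr0)
  refine hv (funext fun a => ?_)
  have := hD' (MvPolynomial.X a)
  exact (mkDerivation_X ℝ v a).symm.trans this

end

/-! ### Rank defect at least two, and coordinates for smaller defect -/

theorem Derivation.leibniz_finset_prod {R A ι : Type*} [CommRing R] [CommRing A] [Algebra R A]
    [DecidableEq ι] (D : Derivation R A A) (s : Finset ι) (f : ι → A) :
    D (∏ i ∈ s, f i) = ∑ i ∈ s, (∏ j ∈ s.erase i, f j) * D (f i) := by
  induction s using Finset.induction_on with
  | empty => simp
  | insert i s hi ih =>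
    rw [Finset.prod_insert hi, D.leibniz, ih, Finset.sum_insert hi, Finset.erase_insert hi,
      smul_eq_mul, smul_eq_mul, Finset.mul_sum, add_comm]
    congr 1
    refine Finset.sum_congr rfl fun j hj => ?_
    have hij : i ≠ j := fun h => hi (h ▸ hj)
    rw [Finset.erase_insert_of_ne hij, Finset.prod_insert (by simp [hi]), mul_assoc]

theorem Derivation.map_det {R A n : Type*} [CommRing R] [CommRing A] [Algebra R A] [Fintype n]
    [DecidableEq n] (D : Derivation R A A) (P : Matrix n n A) :
    D P.det = ∑ b, (P.updateCol b fun a => D (P a b)).det := by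
  simp only [Matrix.det_apply', map_sum, ← zsmul_eq_mul, map_zsmul, D.leibniz_finset_prod]
  rw [Finset.sum_comm]
  refine Finset.sum_congr rfl fun σ _ => ?_
  rw [Finset.smul_sum]
  refine Finset.sum_congr rfl fun b _ => ?_
  rw [← Finset.prod_erase_mul _ _ (Finset.mem_univ b)]
  congr 2
  · refine Finset.prod_congr rfl fun j hj => ?_
    simp [(Finset.mem_erase.1 hj).1]
  · simp

section

variable {m : ℕ} {X : Fin m → ℝ}

theorem det_updateCol_eq_zero {K : Type*} [Field K] {s : Set (Fin m → K)}
    (hs : Module.finrank K (Submodule.span K s) + 1 < m) (P : Matrix (Fin m) (Fin m) K)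
    (hP : ∀ b, (fun a => P a b) ∈ s) (i : Fin m) (u : Fin m → K) : (P.updateCol i u).det = 0 := by
  by_contra h
  have hli := Matrix.linearIndependent_cols_iff_isUnit.2
    ((Matrix.isUnit_iff_isUnit_det _).2 (isUnit_iff_ne_zero.2 h))
  have hli' : LinearIndependent K fun b : {b : Fin m // b ≠ i} =>
      (⟨fun a => P a b, Submodule.subset_span (hP b)⟩ : Submodule.span K s) := by
    refine LinearIndependent.of_comp (Submodule.span K s).subtype ?_
    convert hli.comp _ Subtype.val_injective using 1
    ext b a
    exact (Matrix.updateCol_ne b.2).symm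
  have := hli'.fintype_card_le_finrank
  simp [Fintype.card_subtype_compl] at this
  omega

/-- Differentiating a determinant replaces one column at a time; at rank at most `m - 2` the other
`m - 1` columns are already dependent. -/
theorem gradientMinors_eq_zero_of_finrank_lt {A : Set (MvPolynomial (Fin m) ℝ)}
    (hA : Module.finrank ℝ (Submodule.span ℝ ((fun g => polyGradient g X) '' A)) + 1 < m)
    {p : MvPolynomial (Fin m) ℝ} (hp : p ∈ gradientMinors A) :
    eval X p = 0 ∧ polyGradient p X = 0 := by
  induction hp using Submodule.span_induction with
  | mem x hx =>
    obtain ⟨f, hf, rfl⟩ := hx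
    have hcol : ∀ b, (fun a => (Matrix.of fun a b => polyGradient (f b) X a) a b) ∈
        (fun g => polyGradient g X) '' A := fun b => ⟨f b, hf b, rfl⟩
    constructor
    · rw [eval_det_pderiv]
      have hm : 0 < m := by omega
      rw [← Matrix.updateCol_eq_self (Matrix.of fun a b => polyGradient (f b) X a) ⟨0, hm⟩]
      exact det_updateCol_eq_zero hA _ hcol _ _
    · ext c
      rw [polyGradient, Derivation.map_det, map_sum]
      refine Finset.sum_eq_zero fun b _ => ?_
      rw [RingHom.map_det, RingHom.mapMatrix_apply, Matrix.map_updateCol]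
      exact det_updateCol_eq_zero hA _ hcol _ _
  | zero => simp [polyGradient_zero]
  | add x y _ _ hx hy => simp [polyGradient_add, hx, hy]
  | smul a x _ hx => simp [polyGradient_mul, hx]

theorem eq_bot_of_eventually_mem_realZeros {I : Ideal (MvPolynomial (Fin m) ℝ)}
    (h : ∀ᶠ Y in nhds X, Y ∈ realZeros I) : I = ⊥ := by
  rw [eq_bot_iff]
  intro g hg
  obtain ⟨ε, hε, hball⟩ := Metric.eventually_nhds_iff_ball.1 h
  refine MvPolynomial.funext_set (fun i => Metric.ball (X i) ε)
    (fun i => ?_) fun Y hY => ?_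
  · rw [Real.ball_eq_Ioo]
    exact Set.Ioo_infinite (by linarith)
  · rw [map_zero]
    refine hball Y ?_ g hg
    rw [← ball_pi _ hε] at hY
    exact hY

/-- Without nonzero gradients the regular system of equations is empty, so the variety contains a
neighbourhood of `X`. -/
theorem IsRegularPoint.eq_bot {I : Ideal (MvPolynomial (Fin m) ℝ)} (h : IsRegularPoint I X)
    (hI : ∀ g ∈ I, polyGradient g X = 0) : I = ⊥ := by
  obtain ⟨-, k, g, hg, hli, hev⟩ := h
  have : IsEmpty (Fin k) := ⟨fun i => hli.ne_zero i (hI _ (hg i))⟩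
  exact eq_bot_of_eventually_mem_realZeros (hev.mono fun Y hY => hY fun i => isEmptyElim i)

theorem exists_isCoordinateSystem {A : Set (MvPolynomial (Fin m) ℝ)} (hA : A ⊆ pointIdeal X)
    (hm : 0 < m)
    (h : m ≤ Module.finrank ℝ (Submodule.span ℝ ((fun g => polyGradient g X) '' A)) + 1) :
    ∃ (f : Fin m → MvPolynomial (Fin m) ℝ) (i₀ : Fin m), IsCoordinateSystem f X ∧
      ∀ b ≠ i₀, f b ∈ A := by
  obtain ⟨k, rfl⟩ : ∃ k, m = k + 1 := ⟨m - 1, by omega⟩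
  set s := (fun g => polyGradient g X) '' A
  obtain ⟨u, hu, -, hli⟩ := Submodule.exists_fun_fin_finrank_span_eq ℝ s
  have hk : k ≤ Module.finrank ℝ (Submodule.span ℝ s) := by omega
  have hli' := hli.comp _ (Fin.castLE_injective hk)
  set u' := u ∘ Fin.castLE hk
  have hne : Submodule.span ℝ (Set.range u') ≠ ⊤ := by
    intro htop
    have := finrank_span_eq_card hli'
    rw [htop, finrank_top, Module.finrank_fin_fun, Fintype.card_fin] at this
    omega
  obtain ⟨e, -, he⟩ := SetLike.exists_of_lt hne.lt_top
  choose g hgA hg using fun b : Fin k => hu (Fin.castLE hk b)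
  -- An affine function with gradient `e` outside the span of the chosen gradients completes the
  -- coordinates; it takes the index `0`, which serves as `i₀`.
  let t : MvPolynomial (Fin (k + 1)) ℝ := ∑ a, C (e a) * (MvPolynomial.X a - C (X a))
  have htgrad : polyGradient t X = e := by
    rw [polyGradient_sum]
    ext a
    simp [polyGradient_mul, polyGradient_X_sub_C, Pi.single_apply]
  have hgrad : ∀ b, polyGradient ((Fin.cons t g : Fin (k + 1) → _) b) X =
      (Fin.cons e u' : Fin (k + 1) → _) b := by
    refine Fin.cases ?_ fun b => ?_
    · simpa using htgrad
    · simpa [u'] using hg b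
  have hmem : ∀ b, (Fin.cons t g : Fin (k + 1) → _) b ∈ pointIdeal X := by
    refine Fin.cases ?_ fun b => ?_
    · simp [mem_pointIdeal, t]
    · simpa using hA (hgA b)
  refine ⟨Fin.cons t g, 0, ⟨hmem, ?_⟩, Fin.cases (by simp) fun b _ => ?_⟩
  · have h1 : LinearIndependent ℝ (Fin.cons e u' : Fin (k + 1) → Fin (k + 1) → ℝ) :=
      linearIndependent_finCons.2 ⟨hli', he⟩
    have h2 := (Matrix.isUnit_iff_isUnit_det _).1 (Matrix.linearIndependent_rows_iff_isUnit
      (A := Matrix.of (Fin.cons e u' : Fin (k + 1) → Fin (k + 1) → ℝ)) |>.1 h1)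
    rw [← Matrix.det_transpose] at h2
    convert h2.ne_zero using 2
    ext a b
    simp [hgrad]
  · simpa using hgA b

end

/-! ### Assembling the theorem -/

namespace Framework

variable {d w m : ℕ} (F : Framework d w m)

theorem isFlexibleOfOrder_iff {X : Fin m → ℝ} (hX : X ∈ F.configurations) (n : ℕ) :
    F.IsFlexibleOfOrder n X ↔
      F.shakyIdeal n ≤ pointIdeal X ∧ ¬ F.shakyIdeal (n + 1) ≤ pointIdeal X := by
  rw [IsFlexibleOfOrder, F.mem_flexibleSet_iff hX, F.mem_flexibleSet_iff hX]

theorem shakyIdeal_one (X : Fin m → ℝ) : F.shakyIdeal 1 = gradientMinors (F.constraints X) := by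
  rw [F.shakyIdeal_succ X]
  refine le_antisymm (sup_le bot_le (Ideal.span_le.2 ?_))
    (le_sup_of_le_right (Ideal.span_mono ?_))
  · rintro _ ⟨f, hf, rfl⟩
    by_cases h : ∀ b, f b ∈ F.constraints X
    · exact Ideal.subset_span ⟨f, h, rfl⟩
    · obtain ⟨b, hb⟩ := not_forall.1 h
      have h0 : f b = 0 := (hf b).resolve_left hb
      rw [Matrix.det_eq_zero_of_column_eq_zero b fun a => by simp [h0]]
      exact zero_mem _
  · rintro _ ⟨f, hf, rfl⟩
    exact ⟨f, fun b => Or.inl (hf b), rfl⟩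

theorem shakyIdeal_eq_bot (h : F.shakyIdeal 1 = ⊥) (j : ℕ) : F.shakyIdeal j = ⊥ := by
  induction j with
  | zero => rfl
  | succ j ih => rwa [shakyIdeal, ih]

end Framework

/-- Let `X` be a configuration of a bar-joint framework that is not a singular point of any of the
iterated shakiness varieties `V_1, …, V_n`.  Then `X` is flexible of order `n` in the hierarchical
sense if and only if it is a realization of multiplicity `n + 1`. -/
theorem theorem1 {d w m : ℕ} (F : Framework d w m) (n : ℕ) (X : Fin m → ℝ)
    (hX : X ∈ F.configurations)
    (hreg : ∀ j, 1 ≤ j → j ≤ n → X ∈ F.shakyVariety j → IsRegularPoint (F.shakyIdeal j) X) :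
    F.IsFlexibleOfOrder n X ↔ F.realizationMultiplicity X = (n : ℕ∞) + 1 := by
  have hA := F.constraints_subset_pointIdeal hX
  rw [F.isFlexibleOfOrder_iff hX, Framework.realizationMultiplicity]
  -- With no unknowns there is no index `i₀`; the multiplicity is one and no nonzero flex exists.
  rcases Nat.eq_zero_or_pos m with rfl | hm
  · have h1 : solutionMultiplicity (F.constraints X) X = 1 := by
      have h0 : pointIdeal X = ⊥ := by
        rw [pointIdeal_eq_span, Set.range_eq_empty, Ideal.span_empty]
      rw [solutionMultiplicity_eq_one_iff, ← map_pointIdeal]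
      congr 1
      refine le_antisymm (Ideal.span_le.2 hA) ?_
      rw [h0]
      exact bot_le
    have h2 : ∀ j, ¬ F.shakyIdeal (j + 1) ≤ pointIdeal X := by
      intro j hj
      rw [F.shakyIdeal_succ X, sup_le_iff, gradientMinors_le_pointIdeal_iff] at hj
      obtain ⟨v, hv, -⟩ := hj.2
      exact hv (Subsingleton.elim _ _)
    rw [h1]
    cases n with
    | zero => simpa [Framework.shakyIdeal] using h2 0
    | succ n =>
      refine iff_of_false (fun h => h2 n h.1) fun h => ?_
      have : 1 = n + 1 + 1 := by exact_mod_cast h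
      omega
  by_cases hrank : m ≤ Module.finrank ℝ
      (Submodule.span ℝ ((fun g => polyGradient g X) '' F.constraints X)) + 1
  · obtain ⟨f, i₀, hf, hfA⟩ := exists_isCoordinateSystem hA hm hrank
    rw [F.shakyIdeal_le_pointIdeal_iff hX hf hfA, F.shakyIdeal_le_pointIdeal_iff hX hf hfA,
      hf.solutionMultiplicity_eq_add_one_iff hfA]
  have hI := F.shakyIdeal_one X
  have hzero : ∀ g ∈ F.shakyIdeal 1, eval X g = 0 ∧ polyGradient g X = 0 := fun g hg =>
    gradientMinors_eq_zero_of_finrank_lt (not_le.1 hrank) (hI ▸ hg)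
  have hmem : F.shakyIdeal 1 ≤ pointIdeal X := fun g hg => (hzero g hg).1
  rcases Nat.eq_zero_or_pos n with rfl | hn
  · rw [hI, gradientMinors_le_pointIdeal_iff] at hmem
    obtain ⟨v, hv, hAv⟩ := hmem
    refine iff_of_false (fun h => h.2 fun g hg => (hzero g hg).1) ?_
    simpa using solutionMultiplicity_ne_one hA hv hAv
  -- Regularity of `V_1` is what forces `I_1 = 0`.
  · have hbot := (hreg 1 le_rfl hn hmem).eq_bot fun g hg => (hzero g hg).2
    refine iff_of_false (fun h => h.2 ?_) fun h => ?_
    · rw [F.shakyIdeal_eq_bot hbot]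
      exact bot_le
    · refine exists_minor_ne_zero_of_solutionMultiplicity_ne_top hA ?_ (hI ▸ hbot)
      rw [h]
      exact_mod_cast ENat.natCast_ne_top (n + 1)
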